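/- Let $\Sigma$ be a finite alphabet with at least two letters. A Büchi automaton $\mathcal A$ over $\Sigma$ consists of a finite set $Q$ of states, sets $Q_i,Q_f\subseteq Q$ of initial and final states, and a transition relation $\Delta\subseteq Q\times\Sigma\times Q$. It accepts $x\in\Sigma^{\mathbb N}$ if there is a sequence $(q_k)_{k\in\mathbb N}$ of states with $q_0\in Q_i$, $(q_k,x(k),q_{k+1})\in\Delta$ for all $k$, and $q_k\in Q_f$ for infinitely many $k$; $L(\mathcal A)$ is the set of accepted words, and sets of this form are called $\omega$-regular. The Büchi topology $\tau_B$ on $\Sigma^{\mathbb N}$ is the topology generated by the $\omega$-regular sets. The automaton $\mathcal A$ separates $x$ and $y$ if exactly one of $x,y$ belongs to $L(\mathcal A)$. Put $\delta(x,x)=0$ and, for $x\neq y$, $\delta(x,y)=2^{-n}$, where $n$ is the least number of states of a Büchi automaton which separates $x$ and $y$. Then: 1. $\delta$ is a metric on $\Sigma^{\mathbb N}$, and in fact an ultrametric: $\delta(x,z)\le\max(\delta(x,y),\delta(y,z))$ for all $x,y,z\in\Sigma^{\mathbb N}$. 2. The topology induced by $\delta$ is $\tau_B$. 3. The metric $\delta$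 is not complete. More precisely, for any two distinct letters $a,b\in\Sigma$, the sequence of words $(a^{n!}\,b\,a^{\omega})_{n\in\mathbb N}$ is a $\delta$-Cauchy sequence which does not converge. -/

import Mathlib

universe u

/-- A (nondeterministic) Büchi automaton with input alphabet `A` and set of states `Q`.
Finiteness of `A` and of `Q` is required where automata are quantified over. -/
structure BuchiAutomaton (A : Type u) (Q : Type) where
  /-- the set of initial states -/
  initial : Set Q
  /-- the set of final states -/
  final : Set Q
  /-- the transition relation -/
  trans : Set (Q × A × Q)

namespace BuchiAutomaton

variable {A : Type u} {Q : Type}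

/-- `r` is a run of `M` on the infinite word `x`. -/
def IsRun (M : BuchiAutomaton A Q) (x : ℕ → A) (r : ℕ → Q) : Prop :=
  r 0 ∈ M.initial ∧ ∀ i, (r i, x i, r (i + 1)) ∈ M.trans

/-- The ω-language accepted by `M`: the infinite words having a run which visits final states
infinitely often. -/
def language (M : BuchiAutomaton A Q) : Set (ℕ → A) :=
  {x | ∃ r : ℕ → Q, M.IsRun x r ∧ ∃ᶠ i in Filter.atTop, r i ∈ M.final}

/-- `M` separates `x` and `y` if it accepts exactly one of them. -/
def Separates (M : BuchiAutomaton A Q) (x y : ℕ → A) : Prop :=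
  (x ∈ M.language ∧ y ∉ M.language) ∨ (y ∈ M.language ∧ x ∉ M.language)

end BuchiAutomaton

/-- A set of infinite words is ω-regular if it is accepted by some Büchi automaton with finitely
many states. -/
def IsOmegaRegular {A : Type u} (L : Set (ℕ → A)) : Prop :=
  ∃ (Q : Type) (_ : Finite Q) (M : BuchiAutomaton A Q), M.language = L

/-- The Büchi topology on infinite words, generated by the ω-regular languages. -/
abbrev buchiTopology (A : Type u) : TopologicalSpace (ℕ → A) :=
  TopologicalSpace.generateFrom {L | IsOmegaRegular L}

/-- The least number of states of a Büchi automaton which separates `x` and `y`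
(meaningful for `x ≠ y`, where a separating automaton exists). -/
noncomputable def minSeparatingStates {A : Type u} (x y : ℕ → A) : ℕ :=
  sInf {n | ∃ (Q : Type) (_ : Finite Q) (M : BuchiAutomaton A Q),
    Nat.card Q = n ∧ M.Separates x y}

open Classical in
/-- The Büchi distance: `0` if `x = y`, and otherwise `2⁻ⁿ` for `n` the least number of states of
a Büchi automaton which separates `x` and `y`. -/
noncomputable def buchiDist {A : Type u} (x y : ℕ → A) : ℝ :=
  if x = y then 0 else 1 / 2 ^ minSeparatingStates x y

open Classical in
/-- The infinite word `aᵏ b a^ω`. -/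
noncomputable def singleMarkWord {A : Type u} (a b : A) (k : ℕ) : ℕ → A :=
  fun i => if i = k then b else a

open Filter Topology

/-! If an automaton separates `x` from `z`, it separates `y` from one of them; this gives the
ultrametric inequality. A ball of radius 2⁻ⁿ around `x` consists of the words that no automaton with
at most `n` states separates from `x` (`buchiDist_lt_iff`). Over a finite alphabet there are
finitely many such automata up to renaming states, so the ball is a finite intersection of ω-regular
languages and complements of such. Conversely, a language with a `k`-state automaton contains the
ball of radius 2⁻ᵏ around each of its points.

It remains that complements are open (`isOpen_compl_language`). By Büchi's argument, Ramsey's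
theorem cuts a rejected word into segments of profiles `u, v, v, ...`; the words with such a
factorization form an ω-regular language, all of whose members are rejected.

For incompleteness, the profiles of `aᵏ` are iterates of a self-map of a finite set, hence
eventually constant at `k = n!`. So each automaton treats almost all words of the sequence alike.
The only possible limit is `a^ω`, but `{a^ω}` is open. -/

/-! ### Combinatorics of sequences and iterates -/

/-- A strictly increasing sequence starting at `0` cuts `ℕ` into blocks. -/
lemma StrictMono.exists_blockIndex {n : ℕ → ℕ} (hn : StrictMono n) (h0 : n 0 = 0) :
    ∃ κ : ℕ → ℕ, ∀ i, n (κ i) ≤ i ∧ i < n (κ i + 1) := by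
  have key : ∀ i, ∃ k, n k ≤ i ∧ i < n (k + 1) := by
    intro i
    induction i with
    | zero => exact ⟨0, h0.le, by have : n 0 < n (0 + 1) := hn Nat.zero_lt_one; omega⟩
    | succ i ih =>
      obtain ⟨k, hk, hk'⟩ := ih
      by_cases h : i + 1 < n (k + 1)
      · exact ⟨k, by omega, h⟩
      · refine ⟨k + 1, by omega, ?_⟩
        have := hn (Nat.lt_succ_self (k + 1))
        have : n (k + 1) < n (k + 1 + 1) := this
        omega
  choose κ hκ using key
  exact ⟨κ, hκ⟩

lemma StrictMono.blockIndex_unique {n : ℕ → ℕ} (hn : StrictMono n) {i k l : ℕ}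
    (hk : n k ≤ i) (hk' : i < n (k + 1)) (hl : n l ≤ i) (hl' : i < n (l + 1)) : k = l := by
  have h1 := hn.lt_iff_lt.1 (hk.trans_lt hl')
  have h2 := hn.lt_iff_lt.1 (hl.trans_lt hk')
  omega

/-- A consequence of Ramsey's theorem: for a colouring of pairs of natural numbers with finitely
many colours, some increasing sequence has all pairs of consecutive terms of the same colour. -/
lemma exists_strictMono_consecutive_color {C : Type*} [Finite C] (c : ℕ → ℕ → C) :
    ∃ (n : ℕ → ℕ) (e : C), StrictMono n ∧ 0 < n 0 ∧ ∀ k, c (n k) (n (k + 1)) = e := by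
  have lim : ∀ f : ℕ → C, ∃ e, ∀ᶠ j in (hyperfilter ℕ : Filter ℕ), f j = e := by
    intro f
    obtain ⟨e, -, he⟩ := (Ultrafilter.eventually_exists_mem_iff (f := hyperfilter ℕ)
      (is := Set.univ) (P := fun e j => f j = e) Set.finite_univ).1
      (Eventually.of_forall fun j => ⟨f j, trivial, rfl⟩)
    exact ⟨e, he⟩
  -- `d i` is the limit colour of row `i` along a nonprincipal ultrafilter, and `e` is the limit of
  -- `d`.
  choose d hd using fun i => lim (c i)
  obtain ⟨e, he⟩ := lim d
  have gt : ∀ i : ℕ, ∀ᶠ j in (hyperfilter ℕ : Filter ℕ), i < j := fun i =>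
    (Nat.hyperfilter_le_atTop) (eventually_gt_atTop i)
  have next : ∀ i : {i // d i = e}, ∃ j : {i // d i = e}, i.1 < j.1 ∧ c i j = e := by
    rintro ⟨i, hi⟩
    obtain ⟨j, ⟨h1, h2⟩, h3⟩ := (((hd i).and he).and (gt i)).exists
    exact ⟨⟨j, h2⟩, h3, h1.trans hi⟩
  choose s hs hs' using next
  obtain ⟨i, hi, hi0⟩ := (he.and (gt 0)).exists
  refine ⟨fun k => (s^[k] ⟨i, hi⟩).1, e, strictMono_nat_of_lt_succ fun k => ?_, hi0, fun k => ?_⟩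
  · simp only [Function.iterate_succ_apply']; exact hs _
  · simp only [Function.iterate_succ_apply']; exact hs' _

/-- The iterates of a self-map of a finite type at factorial times are eventually constant. -/
lemma exists_iterate_factorial_eq {T : Type*} [Finite T] (f : T → T) (t : T) :
    ∃ N : ℕ, ∀ n ≥ N, f^[n.factorial] t = f^[N.factorial] t := by
  obtain ⟨i, j, hij, h⟩ : ∃ i j, i < j ∧ f^[i] t = f^[j] t := by
    obtain ⟨i, j, hne, h⟩ := Finite.exists_ne_map_eq_of_infinite (fun i => f^[i] t)
    rcases lt_or_gt_of_ne hne with hlt | hlt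
    exacts [⟨i, j, hlt, h⟩, ⟨j, i, hlt, h.symm⟩]
  obtain ⟨d, rfl⟩ := Nat.exists_eq_add_of_lt hij
  have per : ∀ c l, f^[i + l + (d + 1) * c] t = f^[i + l] t := by
    intro c l
    induction c with
    | zero => simp
    | succ c ih =>
      rw [show i + l + (d + 1) * (c + 1) = (l + (d + 1) * c) + (i + d + 1) by ring,
        Function.iterate_add_apply, ← h, ← Function.iterate_add_apply, ← ih,
        show l + (d + 1) * c + i = i + l + (d + 1) * c by ring]
  -- From here on, factorials exceed the preperiod `i` and are multiples of the period `d + 1`.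
  refine ⟨i + d + 1, fun n hn => ?_⟩
  have hle := Nat.factorial_le hn
  have hd1 : d + 1 ∣ (i + d + 1).factorial := Nat.dvd_factorial (by omega) (by omega)
  have hd2 : d + 1 ∣ n.factorial := Nat.dvd_factorial (by omega) (by omega)
  obtain ⟨c, hc⟩ := Nat.dvd_sub hd2 hd1
  have hi : i + d + 1 ≤ (i + d + 1).factorial := Nat.self_le_factorial _
  obtain ⟨l, hl⟩ := Nat.exists_eq_add_of_le (show i ≤ (i + d + 1).factorial by omega)
  have : n.factorial = i + l + (d + 1) * c := by omega
  rw [this, hl, per]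

namespace BuchiAutomaton

variable {A : Type u} {Q : Type}

/-! ### Profiles of segments of infinite words -/

/-- A profile records between which states there are paths, with the possible truth values of
"the path visits a final state after its start". -/
abbrev Profile (Q : Type) := Q → Q → Prop → Prop

/-- The profile of the empty word. -/
def emptyProfile (Q : Type) : Profile Q := fun p q b => p = q ∧ ¬ b

/-- Appending a letter to a word with profile `t`. -/
def stepProfile (M : BuchiAutomaton A Q) (a : A) (t : Profile Q) : Profile Q :=
  fun p q b => ∃ p' b', t p p' b' ∧ (p', a, q) ∈ M.trans ∧ (b ↔ b' ∨ q ∈ M.final)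

/-- The profile of the segment of `x` from position `i` (included) to `j` (excluded). -/
def segmentProfile (M : BuchiAutomaton A Q) (x : ℕ → A) (i j : ℕ) : Profile Q :=
  fun p q b => ∃ r : ℕ → Q, r i = p ∧ r j = q ∧
    (∀ k, i ≤ k → k < j → (r k, x k, r (k + 1)) ∈ M.trans) ∧
    (b ↔ ∃ k, i < k ∧ k ≤ j ∧ r k ∈ M.final)

lemma segmentProfile_self (M : BuchiAutomaton A Q) (x : ℕ → A) (i : ℕ) :
    M.segmentProfile x i i = emptyProfile Q := by
  funext p q b
  apply propext
  constructor
  · rintro ⟨r, rfl, rfl, -, h⟩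
    exact ⟨rfl, fun hb => by obtain ⟨k, h1, h2, -⟩ := h.1 hb; omega⟩
  · rintro ⟨rfl, hb⟩
    exact ⟨fun _ => p, rfl, rfl, fun k _ _ => by omega,
      ⟨fun h => (hb h).elim, fun ⟨k, _, _, _⟩ => by omega⟩⟩

lemma segmentProfile_succ (M : BuchiAutomaton A Q) (x : ℕ → A) {i j : ℕ} (hij : i ≤ j) :
    M.segmentProfile x i (j + 1) = M.stepProfile (x j) (M.segmentProfile x i j) := by
  funext p q b
  apply propext
  constructor
  · rintro ⟨r, rfl, rfl, h, hb⟩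
    refine ⟨r j, _, ⟨r, rfl, rfl, fun k h1 h2 => h k h1 (by omega), Iff.rfl⟩,
      h j hij (by omega), hb.trans ⟨?_, ?_⟩⟩
    · rintro ⟨k, h1, h2, h3⟩
      rcases Nat.lt_or_eq_of_le h2 with h2 | rfl
      exacts [Or.inl ⟨k, h1, by omega, h3⟩, Or.inr h3]
    · rintro (⟨k, h1, h2, h3⟩ | h3)
      exacts [⟨k, h1, by omega, h3⟩, ⟨j + 1, by omega, le_rfl, h3⟩]
  · rintro ⟨p', b', ⟨r, rfl, rfl, h, hb'⟩, ht, hb⟩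
    have hr : ∀ k ≤ j, Function.update r (j + 1) q k = r k := fun k hk =>
      Function.update_of_ne (by omega) _ _
    refine ⟨Function.update r (j + 1) q, hr i hij, Function.update_self .., ?_, ?_⟩
    · intro k h1 h2
      rw [hr k (by omega)]
      rcases Nat.lt_or_eq_of_le (Nat.le_of_lt_succ h2) with h2 | rfl
      · rw [hr (k + 1) h2]; exact h k h1 h2
      · rw [Function.update_self]; exact ht
    · rw [hb, hb']
      constructor
      · rintro (⟨k, h1, h2, h3⟩ | h3)
        · exact ⟨k, h1, by omega, by rwa [hr k h2]⟩
        · exact ⟨j + 1, by omega, le_rfl, by rwa [Function.update_self]⟩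
      · rintro ⟨k, h1, h2, h3⟩
        rcases Nat.lt_or_eq_of_le h2 with h2 | rfl
        · exact Or.inl ⟨k, h1, by omega, by rwa [hr k (by omega)] at h3⟩
        · rw [Function.update_self] at h3; exact Or.inr h3

/-- Words which can be cut into segments with the same profiles are not separated. -/
lemma mem_language_of_segmentProfile_eq (M : BuchiAutomaton A Q) {y z : ℕ → A} {n m : ℕ → ℕ}
    (hn : StrictMono n) (hn0 : n 0 = 0) (hm : StrictMono m) (hm0 : m 0 = 0)
    (h : ∀ k, M.segmentProfile y (n k) (n (k + 1)) = M.segmentProfile z (m k) (m (k + 1)))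
    (hz : z ∈ M.language) : y ∈ M.language := by
  obtain ⟨r, ⟨hr0, hr⟩, hinf⟩ := hz
  -- Each block of the accepting run on `z` is replaced by a path over the matching block of `y`,
  -- with the same end states and the same answer about final visits.
  have hp : ∀ k, M.segmentProfile y (n k) (n (k + 1)) (r (m k)) (r (m (k + 1)))
      (∃ j, m k < j ∧ j ≤ m (k + 1) ∧ r j ∈ M.final) := fun k => by
    rw [h k]; exact ⟨r, rfl, rfl, fun i _ _ => hr i, Iff.rfl⟩
  choose p hp0 hp1 hpt hpf using hp
  obtain ⟨κ, hκ⟩ := hn.exists_blockIndex hn0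
  -- The chosen paths agree at the cuts, so they glue to a single run.
  have hstart : ∀ i, p (κ (i + 1)) (i + 1) = p (κ i) (i + 1) := by
    intro i
    obtain ⟨h1, h2⟩ := hκ i
    obtain ⟨h3, h4⟩ := hκ (i + 1)
    by_cases hi : i + 1 < n (κ i + 1)
    · rw [hn.blockIndex_unique h3 h4 (by omega) hi]
    · have hi' : i + 1 = n (κ i + 1) := by omega
      have : κ (i + 1) = κ i + 1 :=
        hn.blockIndex_unique h3 h4 (by omega) (by rw [hi']; exact hn (Nat.lt_succ_self _))
      rw [this, hi', hp0, hp1]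
  have hblock : ∀ k i, n k < i → i ≤ n (k + 1) → p (κ i) i = p k i := by
    intro k i h1 h2
    obtain ⟨i, rfl⟩ : ∃ j, i = j + 1 := ⟨i - 1, by omega⟩
    obtain ⟨h3, h4⟩ := hκ i
    rw [hstart, hn.blockIndex_unique h3 h4 (show n k ≤ i by omega) (by omega)]
  refine ⟨fun i => p (κ i) i, ⟨?_, fun i => ?_⟩, ?_⟩
  · have : κ 0 = 0 := hn.blockIndex_unique (hκ 0).1 (hκ 0).2 hn0.le
      (by have : n 0 < n (0 + 1) := hn Nat.zero_lt_one; omega)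
    change p (κ 0) 0 ∈ M.initial
    have h0 := hp0 0
    rw [hn0, hm0] at h0
    rwa [this, h0]
  · change (p (κ i) i, y i, p (κ (i + 1)) (i + 1)) ∈ M.trans
    rw [hstart]
    exact hpt _ i (hκ i).1 (hκ i).2
  · rw [frequently_atTop] at hinf ⊢
    intro N
    obtain ⟨j, hj, hjf⟩ := hinf (m N + 1)
    obtain ⟨μ, hμ⟩ := hm.exists_blockIndex hm0
    -- Profiles count final visits after the start of a block up to and including its end, so the
    -- block responsible for `j` is the one containing `j - 1`.
    obtain ⟨h1, h2⟩ := hμ (j - 1)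
    obtain ⟨i, hi1, hi2, hi3⟩ := (hpf (μ (j - 1))).1 ⟨j, by omega, by omega, hjf⟩
    refine ⟨i, ?_, by change p (κ i) i ∈ M.final; rwa [hblock _ i hi1 hi2]⟩
    have : N < μ (j - 1) + 1 := hm.lt_iff_lt.1 (by omega)
    have h5 : n N ≤ n (μ (j - 1)) := hn.monotone (by omega)
    have := hn.id_le N
    simp only [id] at this
    omega

/-! ### Automata for ultimately constant factorizations -/

/-- The automaton which cuts its input into segments, the first with profile `u` and the others
with profile `v`. Its states carry the profile read since the last cut, the expected profile, and
whether a cut has just been made. -/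
def factorAutomaton (M : BuchiAutomaton A Q) (u v : Profile Q) :
    BuchiAutomaton A (Profile Q × Profile Q × Prop) where
  initial := {(emptyProfile Q, u, True)}
  final := {s | s.2.2}
  -- Without a cut, the letter extends the current profile. With a cut, the completed profile must
  -- be the expected one; the current profile is then reset and `v` is expected next.
  trans := {e | (¬ e.2.2.2.2 ∧ e.2.2.1 = M.stepProfile e.2.1 e.1.1 ∧ e.2.2.2.1 = e.1.2.1) ∨
    (e.2.2.2.2 ∧ e.2.2.1 = emptyProfile Q ∧ e.2.2.2.1 = v ∧
      M.stepProfile e.2.1 e.1.1 = e.1.2.1)}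

/-- The cuts are the times when the run is in a final state, so Büchi acceptance says exactly that
there are infinitely many; `Nat.nth` enumerates them. -/
lemma mem_language_factorAutomaton (M : BuchiAutomaton A Q) (u v : Profile Q) (x : ℕ → A) :
    x ∈ (M.factorAutomaton u v).language ↔ ∃ n : ℕ → ℕ, StrictMono n ∧ n 0 = 0 ∧
      ∀ k, M.segmentProfile x (n k) (n (k + 1)) = if k = 0 then u else v := by
  constructor
  · rintro ⟨r, ⟨hr0, hr⟩, hinf⟩
    have hr0 : r 0 = (emptyProfile Q, u, True) := hr0
    set P : ℕ → Prop := fun i => (r i).2.2 with hP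
    have hPinf : {i | P i}.Infinite := Nat.frequently_atTop_iff_infinite.1 hinf
    have hP0 : P 0 := by rw [hP]; simp [hr0]
    have hn0 : Nat.nth P 0 = 0 := Nat.nth_zero_of_zero hP0
    have hcut : ∀ k, P (Nat.nth P k) := fun k => Nat.nth_mem_of_infinite hPinf k
    have hmono : StrictMono (Nat.nth P) := Nat.nth_strictMono hPinf
    have hstart : ∀ k, (r (Nat.nth P k)).1 = emptyProfile Q ∧
        (r (Nat.nth P k)).2.1 = if k = 0 then u else v := by
      rintro (_ | k)
      · rw [hn0, hr0]; simp
      · obtain ⟨i, hi⟩ : ∃ i, Nat.nth P (k + 1) = i + 1 :=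
          Nat.exists_eq_succ_of_ne_zero (Nat.ne_zero_of_lt (hmono (Nat.lt_succ_self k)))
        have hc := hcut (k + 1)
        rw [hi] at hc ⊢
        rcases hr i with h | h
        · exact (h.1 hc).elim
        · exact ⟨h.2.1, by simpa using h.2.2.1⟩
    have hinv : ∀ k i, Nat.nth P k ≤ i → i < Nat.nth P (k + 1) →
        (r i).1 = M.segmentProfile x (Nat.nth P k) i ∧
          (r i).2.1 = if k = 0 then u else v := by
      intro k i hi
      induction i, hi using Nat.le_induction with
      | base => intro _; rw [segmentProfile_self]; exact hstart k
      | succ i hi ih =>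
        intro hlt
        obtain ⟨h1, h2⟩ := ih (by omega)
        rcases hr i with h | h
        · rw [segmentProfile_succ _ _ hi, ← h1, ← h2]; exact h.2
        · have := Nat.le_nth_of_lt_nth_succ hlt h.1
          omega
    refine ⟨Nat.nth P, hmono, hn0, fun k => ?_⟩
    have hlt : Nat.nth P k < Nat.nth P (k + 1) := hmono (Nat.lt_succ_self k)
    obtain ⟨i, hi⟩ : ∃ i, Nat.nth P (k + 1) = i + 1 := ⟨Nat.nth P (k + 1) - 1, by omega⟩
    obtain ⟨h1, h2⟩ := hinv k i (by omega) (by omega)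
    have hc := hcut (k + 1)
    rw [hi] at hc ⊢
    rcases hr i with h | h
    · exact (h.1 hc).elim
    · rw [segmentProfile_succ _ _ (by omega), ← h1, ← h2]; exact h.2.2.2
  · rintro ⟨n, hn, hn0, hp⟩
    obtain ⟨κ, hκ⟩ := hn.exists_blockIndex hn0
    have hκ0 : κ 0 = 0 := hn.blockIndex_unique (hκ 0).1 (hκ 0).2 hn0.le
      (by have : n 0 < n (0 + 1) := hn Nat.zero_lt_one; omega)
    have hκn : ∀ k, κ (n k) = k := fun k =>
      hn.blockIndex_unique (hκ _).1 (hκ _).2 le_rfl (hn (Nat.lt_succ_self k))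
    refine ⟨fun i => (M.segmentProfile x (n (κ i)) i, if κ i = 0 then u else v, i = n (κ i)),
      ⟨?_, fun i => ?_⟩, ?_⟩
    · change (_, _, _) = (_, _, _)
      simp [hκ0, hn0, segmentProfile_self]
    · obtain ⟨h1, h2⟩ := hκ i
      obtain ⟨h3, h4⟩ := hκ (i + 1)
      by_cases hi : i + 1 < n (κ i + 1)
      · left
        have he : κ (i + 1) = κ i := hn.blockIndex_unique h3 h4 (by omega) hi
        dsimp only
        rw [he, segmentProfile_succ _ _ h1]
        exact ⟨by omega, rfl, rfl⟩
      · right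
        have hi' : i + 1 = n (κ i + 1) := by omega
        have he : κ (i + 1) = κ i + 1 := by rw [hi', hκn]
        have := hp (κ i)
        dsimp only
        rw [he, ← hi', segmentProfile_self, ← segmentProfile_succ _ _ h1, hi', this]
        exact ⟨rfl, rfl, by simp, rfl⟩
    · rw [frequently_atTop]
      intro N
      exact ⟨n N, hn.id_le N, by change n N = n (κ (n N)); rw [hκn]⟩

/-- The words rejected by a finite Büchi automaton form a union of ω-regular languages. -/
lemma isOpen_compl_language [Finite Q] (M : BuchiAutomaton A Q) :
    IsOpen[buchiTopology A] M.languageᶜ := by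
  let _ := buchiTopology A
  rw [isOpen_iff_forall_mem_open]
  intro y hy
  obtain ⟨n, v, hn, hpos, hv⟩ := exists_strictMono_consecutive_color (M.segmentProfile y)
  set u := M.segmentProfile y 0 (n 0)
  have hy' : y ∈ (M.factorAutomaton u v).language := by
    rw [mem_language_factorAutomaton]
    refine ⟨fun k => Nat.casesOn k 0 n, strictMono_nat_of_lt_succ ?_, rfl, ?_⟩
    · rintro (_ | k)
      exacts [hpos, hn (Nat.lt_succ_self k)]
    · rintro (_ | k)
      exacts [rfl, hv k]
  -- A word `z` in this neighbourhood has the same sequence of profiles as `y`; were `z` accepted by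
  -- `M`, so would be `y`.
  refine ⟨(M.factorAutomaton u v).language, fun z hz hzM => hy ?_,
    TopologicalSpace.isOpen_generateFrom_of_mem ⟨_, inferInstance, _, rfl⟩, hy'⟩
  rw [mem_language_factorAutomaton] at hz hy'
  obtain ⟨m, hm, hm0, hmp⟩ := hz
  obtain ⟨l, hl, hl0, hlp⟩ := hy'
  exact M.mem_language_of_segmentProfile_eq hl hl0 hm hm0 (fun k => (hlp k).trans (hmp k).symm) hzM

lemma isOpen_language [Finite Q] (M : BuchiAutomaton A Q) :
    IsOpen[buchiTopology A] M.language :=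
  TopologicalSpace.isOpen_generateFrom_of_mem ⟨_, inferInstance, _, rfl⟩

lemma isOpen_not_separates [Finite Q] (M : BuchiAutomaton A Q) (x : ℕ → A) :
    IsOpen[buchiTopology A] {y | ¬ M.Separates x y} := by
  by_cases hx : x ∈ M.language
  · convert M.isOpen_language using 1
    ext y; simp [Separates, hx]
  · convert M.isOpen_compl_language using 1
    ext y; simp [Separates, hx]

/-! ### Renaming states -/

/-- This is where finiteness of the alphabet enters: with state sets `Fin k`, only finitely many
automata have to be tested for a given radius. -/
instance [Finite A] [Finite Q] : Finite (BuchiAutomaton A Q) :=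
  Finite.of_injective (fun M => (M.initial, M.final, M.trans)) <| by
    rintro ⟨i, f, t⟩ ⟨i', f', t'⟩ h
    simpa using h

/-- Renaming the states along an equivalence. -/
def mapEquiv {Q' : Type} (M : BuchiAutomaton A Q) (e : Q' ≃ Q) : BuchiAutomaton A Q' where
  initial := e ⁻¹' M.initial
  final := e ⁻¹' M.final
  trans := {t | (e t.1, t.2.1, e t.2.2) ∈ M.trans}

lemma language_mapEquiv {Q' : Type} (M : BuchiAutomaton A Q) (e : Q' ≃ Q) :
    (M.mapEquiv e).language = M.language := by
  ext x
  constructor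
  · rintro ⟨r, ⟨h0, h⟩, hf⟩
    exact ⟨fun i => e (r i), ⟨h0, h⟩, hf⟩
  · rintro ⟨r, ⟨h0, h⟩, hf⟩
    refine ⟨fun i => e.symm (r i), ⟨?_, fun i => ?_⟩, ?_⟩
    · simpa [mapEquiv] using h0
    · simpa [mapEquiv] using h i
    · simpa [mapEquiv] using hf

lemma Separates.left_or_right {M : BuchiAutomaton A Q} {x y z : ℕ → A} (h : M.Separates x z) :
    M.Separates x y ∨ M.Separates y z := by
  unfold Separates at *
  tauto

/-! ### Cylinders and constant words -/

/-- The automaton which checks that the letter at position `i` is `c`. -/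
def cylinderAutomaton (i : ℕ) (c : A) : BuchiAutomaton A (Fin (i + 2)) where
  initial := {0}
  final := Set.univ
  -- The state counts the letters read, saturating at `i + 1`.
  trans := {t | t.2.2.val = min (t.1.val + 1) (i + 1) ∧ (t.1.val = i → t.2.1 = c)}

lemma language_cylinderAutomaton (i : ℕ) (c : A) :
    (cylinderAutomaton i c).language = {x | x i = c} := by
  ext x
  constructor
  · rintro ⟨r, ⟨h0, h⟩, -⟩
    have h0 : r 0 = 0 := h0
    have hr : ∀ j ≤ i, (r j).val = j := by
      intro j
      induction j with
      | zero => intro _; simp [h0]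
      | succ j ih =>
        intro hj
        have := (h j).1
        simp only [ih (by omega)] at this
        omega
    exact (h i).2 (hr i le_rfl)
  · intro hx
    refine ⟨fun j => ⟨min j (i + 1), by omega⟩, ⟨?_, fun j => ⟨?_, fun hj => ?_⟩⟩,
      Frequently.of_forall fun _ => trivial⟩
    · exact Fin.ext (by simp)
    · simp only; omega
    · simp only at hj ⊢
      obtain rfl : j = i := by omega
      exact hx

/-- The one-state automaton which accepts only the constant word `a^ω`. -/
def constAutomaton (a : A) : BuchiAutomaton A Unit where
  initial := Set.univ
  final := Set.univ
  trans := {t | t.2.1 = a}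

lemma language_constAutomaton (a : A) : (constAutomaton a).language = {fun _ => a} := by
  ext x
  constructor
  · rintro ⟨r, ⟨-, h⟩, -⟩
    exact funext h
  · rintro rfl
    exact ⟨fun _ => (), ⟨trivial, fun _ => rfl⟩, Frequently.of_forall fun _ => trivial⟩

/-! ### Pumping -/

lemma segmentProfile_eq_iterate (M : BuchiAutomaton A Q) {x : ℕ → A} {a : A} {k : ℕ}
    (hx : ∀ i < k, x i = a) :
    M.segmentProfile x 0 k = (M.stepProfile a)^[k] (emptyProfile Q) := by
  induction k with
  | zero => rw [segmentProfile_self]; rfl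
  | succ k ih =>
    rw [segmentProfile_succ _ _ (Nat.zero_le k), ih fun i hi => hx i (by omega),
      hx k (by omega), Function.iterate_succ_apply']

/-- Both words are cut after their initial power of `a` and then letter by letter: the initial
profiles agree by `h`, and the tails `b a^ω` are identical. -/
lemma singleMarkWord_mem_language (M : BuchiAutomaton A Q) (a b : A) {k l : ℕ} (hk : 0 < k)
    (hl : 0 < l)
    (h : (M.stepProfile a)^[k] (emptyProfile Q) = (M.stepProfile a)^[l] (emptyProfile Q))
    (hmem : singleMarkWord a b l ∈ M.language) : singleMarkWord a b k ∈ M.language := by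
  have cuts : ∀ K, 0 < K → StrictMono (fun j : ℕ => (Nat.casesOn j 0 fun i => K + i : ℕ)) := by
    intro K hK
    refine strictMono_nat_of_lt_succ ?_
    rintro (_ | j)
    exacts [hK, Nat.lt_succ_self (K + j)]
  refine M.mem_language_of_segmentProfile_eq (cuts k hk) rfl (cuts l hl) rfl ?_ hmem
  have first : ∀ K, M.segmentProfile (singleMarkWord a b K) 0 K =
      (M.stepProfile a)^[K] (emptyProfile Q) := fun K =>
    M.segmentProfile_eq_iterate fun i hi => if_neg hi.ne
  rintro (_ | j)
  · exact (first k).trans (h.trans (first l).symm)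
  · change M.segmentProfile _ (k + j) (k + j + 1) = M.segmentProfile _ (l + j) (l + j + 1)
    rw [segmentProfile_succ _ _ le_rfl, segmentProfile_succ _ _ le_rfl, segmentProfile_self,
      segmentProfile_self]
    congr 1
    simp [singleMarkWord]

lemma exists_forall_not_separates_singleMarkWord [Finite Q] (M : BuchiAutomaton A Q) (a b : A) :
    ∃ N : ℕ, ∀ n ≥ N, ∀ m ≥ N, ¬ M.Separates (singleMarkWord a b n.factorial)
      (singleMarkWord a b m.factorial) := by
  obtain ⟨N, hN⟩ := exists_iterate_factorial_eq (M.stepProfile a) (emptyProfile Q)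
  refine ⟨N, fun n hn m hm => ?_⟩
  have h := (hN n hn).trans (hN m hm).symm
  rintro (⟨h1, h2⟩ | ⟨h1, h2⟩)
  · exact h2 (M.singleMarkWord_mem_language a b m.factorial_pos n.factorial_pos h.symm h1)
  · exact h2 (M.singleMarkWord_mem_language a b n.factorial_pos m.factorial_pos h h1)

end BuchiAutomaton

/-! ### The Büchi distance -/

section Distance

variable {A : Type u}

open BuchiAutomaton

/-- Distinct words differ at some position, and a cylinder automaton detects this; hence the infimum
is over a nonempty set and is attained. -/
lemma exists_minSeparatingStates {x y : ℕ → A} (h : x ≠ y) :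
    ∃ M : BuchiAutomaton A (Fin (minSeparatingStates x y)), M.Separates x y := by
  obtain ⟨i, hi⟩ := Function.ne_iff.1 h
  have hne : {n | ∃ (Q : Type) (_ : Finite Q) (M : BuchiAutomaton A Q),
      Nat.card Q = n ∧ M.Separates x y}.Nonempty := by
    refine ⟨_, Fin (i + 2), inferInstance, cylinderAutomaton i (x i), rfl, Or.inl ?_⟩
    rw [language_cylinderAutomaton]
    exact ⟨rfl, fun h => hi h.symm⟩
  obtain ⟨Q, _, M, hcard, hM⟩ := Nat.sInf_mem hne
  have e : Fin (minSeparatingStates x y) ≃ Q :=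
    (finCongr hcard.symm).trans (Finite.equivFin Q).symm
  refine ⟨M.mapEquiv e, ?_⟩
  rwa [Separates, language_mapEquiv]

lemma minSeparatingStates_le {Q : Type} [Finite Q] {M : BuchiAutomaton A Q} {x y : ℕ → A}
    (h : M.Separates x y) : minSeparatingStates x y ≤ Nat.card Q :=
  Nat.sInf_le ⟨Q, inferInstance, M, rfl, h⟩

lemma BuchiAutomaton.Separates.ne {Q : Type} {M : BuchiAutomaton A Q} {x y : ℕ → A}
    (h : M.Separates x y) : x ≠ y := by
  rintro rfl
  unfold Separates at h
  tauto

lemma buchiDist_lt_iff {x y : ℕ → A} {n : ℕ} :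
    buchiDist x y < 1 / 2 ^ n ↔
      ∀ s : (k : Fin (n + 1)) × BuchiAutomaton A (Fin k), ¬ s.2.Separates x y := by
  have hlt : ∀ m : ℕ, (1 : ℝ) / 2 ^ m < 1 / 2 ^ n ↔ n < m := fun m => by
    rw [one_div_lt_one_div (by positivity) (by positivity)]
    exact pow_lt_pow_iff_right₀ one_lt_two
  constructor
  · rintro h ⟨k, M⟩ hM
    rw [buchiDist, if_neg hM.ne, hlt] at h
    have := minSeparatingStates_le hM
    have hk := k.2
    simp only [Nat.card_eq_fintype_card, Fintype.card_fin] at this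
    omega
  · intro h
    by_cases hxy : x = y
    · rw [buchiDist, if_pos hxy]; positivity
    · rw [buchiDist, if_neg hxy, hlt]
      by_contra! hle
      obtain ⟨M, hM⟩ := exists_minSeparatingStates hxy
      exact h ⟨⟨_, Nat.lt_succ_of_le hle⟩, M⟩ hM

lemma buchiDist_self (x : ℕ → A) : buchiDist x x = 0 := if_pos rfl

lemma buchiDist_nonneg (x y : ℕ → A) : 0 ≤ buchiDist x y := by
  unfold buchiDist; split_ifs <;> positivity

lemma eq_of_buchiDist_eq_zero {x y : ℕ → A} (h : buchiDist x y = 0) : x = y := by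
  by_contra hxy
  rw [buchiDist, if_neg hxy] at h
  have : (0 : ℝ) < 1 / 2 ^ minSeparatingStates x y := by positivity
  exact this.ne' h

lemma buchiDist_comm (x y : ℕ → A) : buchiDist x y = buchiDist y x := by
  have : minSeparatingStates x y = minSeparatingStates y x := by
    unfold minSeparatingStates
    simp only [Separates, or_comm]
  by_cases hxy : x = y
  · rw [hxy]
  · rw [buchiDist, buchiDist, if_neg hxy, if_neg (Ne.symm hxy), this]

lemma buchiDist_le_max (x y z : ℕ → A) :
    buchiDist x z ≤ max (buchiDist x y) (buchiDist y z) := by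
  by_contra! h
  by_cases hxz : x = z
  · subst hxz
    rw [buchiDist_self] at h
    exact (h.trans_le ((buchiDist_nonneg x y).trans (le_max_left _ _))).false
  -- Both distances are below 2⁻ⁿ for the minimal `n` separating `x` and `z`, so the minimal
  -- automaton itself separates neither pair.
  · rw [max_lt_iff, buchiDist.eq_1 x z, if_neg hxz, buchiDist_lt_iff, buchiDist_lt_iff] at h
    obtain ⟨M, hM⟩ := exists_minSeparatingStates hxz
    rcases hM.left_or_right (y := y) with h' | h'
    exacts [h.1 ⟨Fin.last _, M⟩ h', h.2 ⟨Fin.last _, M⟩ h']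

/-- The metric space structure on infinite words given by the Büchi distance. -/
noncomputable abbrev buchiMetricSpace (A : Type u) : MetricSpace (ℕ → A) where
  dist := buchiDist
  dist_self := buchiDist_self
  dist_comm := buchiDist_comm
  dist_triangle x y z := (buchiDist_le_max x y z).trans
    (max_le_add_of_nonneg (buchiDist_nonneg x y) (buchiDist_nonneg y z))
  eq_of_dist_eq_zero := eq_of_buchiDist_eq_zero

lemma BuchiAutomaton.isOpen_language_buchiMetricSpace {Q : Type} [Finite Q]
    (M : BuchiAutomaton A Q) :
    IsOpen[(buchiMetricSpace A).toUniformSpace.toTopologicalSpace] M.language := by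
  let _ := buchiMetricSpace A
  rw [Metric.isOpen_iff]
  intro x hx
  refine ⟨1 / 2 ^ Nat.card Q, by positivity, fun y hy => ?_⟩
  rw [Metric.mem_ball'] at hy
  have hy := buchiDist_lt_iff.1 hy ⟨Fin.last _, M.mapEquiv (Finite.equivFin Q).symm⟩
  simp only [Separates, language_mapEquiv] at hy
  tauto

lemma toTopologicalSpace_buchiMetricSpace [Finite A] :
    (buchiMetricSpace A).toUniformSpace.toTopologicalSpace = buchiTopology A := by
  refine le_antisymm ?_ ?_
  · refine le_generateFrom ?_
    rintro _ ⟨Q, _, M, rfl⟩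
    exact M.isOpen_language_buchiMetricSpace
  · intro U hU
    let _ := buchiTopology A
    rw [isOpen_iff_forall_mem_open]
    intro x hx
    obtain ⟨ε, hε, hball⟩ := (@Metric.isOpen_iff _ (buchiMetricSpace A).toPseudoMetricSpace U).1
      hU x hx
    obtain ⟨n, hn⟩ := exists_pow_lt_of_lt_one hε (one_half_lt_one (α := ℝ))
    refine ⟨⋂ s : (k : Fin (n + 1)) × BuchiAutomaton A (Fin k), {y | ¬ s.2.Separates x y},
      fun y hy => hball ?_, isOpen_iInter_of_finite fun s => s.2.isOpen_not_separates x, ?_⟩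
    · rw [@Metric.mem_ball' _ (buchiMetricSpace A).toPseudoMetricSpace]
      refine lt_trans ?_ hn
      rw [one_div_pow]
      exact buchiDist_lt_iff.2 fun s => Set.mem_iInter.1 hy s
    · exact Set.mem_iInter.2 fun s hs => hs.ne rfl

lemma cauchySeq_singleMarkWord_factorial [Finite A] (a b : A) :
    letI := buchiMetricSpace A
    CauchySeq fun n : ℕ => singleMarkWord a b n.factorial := by
  let _ := buchiMetricSpace A
  refine Metric.cauchySeq_iff.2 fun ε hε => ?_
  obtain ⟨n, hn⟩ := exists_pow_lt_of_lt_one hε (one_half_lt_one (α := ℝ))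
  choose N hN using fun s : (k : Fin (n + 1)) × BuchiAutomaton A (Fin k) =>
    s.2.exists_forall_not_separates_singleMarkWord a b
  obtain ⟨K, hK⟩ := (Set.finite_range N).bddAbove
  have hK : ∀ s, N s ≤ K := fun s => hK ⟨s, rfl⟩
  refine ⟨K, fun i hi j hj => lt_trans ?_ hn⟩
  rw [one_div_pow]
  exact buchiDist_lt_iff.2 fun s => hN s i ((hK s).trans hi) j ((hK s).trans hj)

lemma not_tendsto_singleMarkWord_factorial {a b : A} (hab : a ≠ b) (l : ℕ → A) :
    letI := buchiMetricSpace A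
    ¬ Tendsto (fun n : ℕ => singleMarkWord a b n.factorial) atTop (nhds l) := by
  let _ := buchiMetricSpace A
  intro h
  -- The point `a^ω` is isolated, and no word of the sequence equals it. Any other `l` has a letter
  -- `l i ≠ a`, whereas the words with `n! > i` carry `a` at position `i`.
  by_cases hl : l = fun _ => a
  · have hmem : (constAutomaton a).language ∈ nhds l :=
      (constAutomaton a).isOpen_language_buchiMetricSpace.mem_nhds
        (by rw [language_constAutomaton]; exact hl)
    obtain ⟨n, hn⟩ := (h.eventually_mem hmem).exists
    rw [language_constAutomaton] at hn
    have := congrFun (Set.mem_singleton_iff.1 hn) n.factorial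
    simp only [singleMarkWord, if_true] at this
    exact hab this.symm
  · obtain ⟨i, hi⟩ := Function.ne_iff.1 hl
    have hmem : (cylinderAutomaton i (l i)).language ∈ nhds l :=
      (cylinderAutomaton i (l i)).isOpen_language_buchiMetricSpace.mem_nhds
        (by rw [language_cylinderAutomaton]; rfl)
    obtain ⟨n, hn, hin⟩ := ((h.eventually_mem hmem).and (eventually_gt_atTop i)).exists
    rw [language_cylinderAutomaton] at hn
    have hn : singleMarkWord a b n.factorial i = l i := hn
    have hne : i ≠ n.factorial := by
      have := n.self_le_factorial
      omega
    rw [singleMarkWord, if_neg hne] at hn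
    exact hi hn.symm

end Distance

/-- `buchiDist` is the distance function of a metric space structure on the infinite words over a
finite alphabet with at least two letters. This metric is an ultrametric, its topology is the Büchi
topology, and it is not complete: for distinct letters `a`, `b`, the sequence `a^(n!) b a^ω` is
Cauchy and has no limit. -/
theorem mainTheorem6 (A : Type u) [Finite A] [Nontrivial A] :
    ∃ m : MetricSpace (ℕ → A),
      (∀ x y, m.dist x y = buchiDist x y) ∧
      (∀ x y z : ℕ → A, buchiDist x z ≤ max (buchiDist x y) (buchiDist y z)) ∧
      m.toUniformSpace.toTopologicalSpace = buchiTopology A ∧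
      ¬ CompleteSpace (ℕ → A) ∧
      ∀ a b : A, a ≠ b →
        CauchySeq (fun n : ℕ => singleMarkWord a b n.factorial) ∧
        ¬ ∃ l : ℕ → A, Filter.Tendsto (fun n : ℕ => singleMarkWord a b n.factorial)
          Filter.atTop (nhds l) := by
  refine ⟨buchiMetricSpace A, fun _ _ => rfl, buchiDist_le_max,
    toTopologicalSpace_buchiMetricSpace, fun hc => ?_, fun a b hab =>
      ⟨cauchySeq_singleMarkWord_factorial a b, fun ⟨l, hl⟩ =>
        not_tendsto_singleMarkWord_factorial hab l hl⟩⟩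
  obtain ⟨a, b, hab⟩ := exists_pair_ne A
  let _ := buchiMetricSpace A
  obtain ⟨l, hl⟩ := cauchySeq_tendsto_of_complete (cauchySeq_singleMarkWord_factorial a b)
  exact not_tendsto_singleMarkWord_factorial hab l hl
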